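/- A (directed) graph $\Gamma$ consists of a set $\Gamma^0$ of vertices, a set $\Gamma^1$ of edges and maps $s,r:\Gamma^1\to\Gamma^0$ (source and range). Each edge $e$ has a formal inverse edge $e^*$ with $s(e^*)=r(e)$, $r(e^*)=s(e)$, $(e^*)^*=e$. A path is a finite sequence $e_1\cdots e_n$ of edges and inverse edges with $r(e_i)=s(e_{i+1})$ (for $n=0$, a vertex). $\Gamma$ is connected if any two vertices are joined by a path; it is a tree if it is connected and has no reduced circuit of positive length, where a reduced circuit is a path $e_1\cdots e_n$ from a vertex to itself with $e_i\ne e_{i+1}^*$ for $1\le i<n$ and $e_1\neq e_n^*$. A graph morphism is a directed immersion if, for every vertex $v$, it is injective on the set of edges with source $v$; the circle is the graph with one vertex and one edge. For a field $F$, the Leavitt path algebra $L_F(\Gamma)$ is the associative (not necessarily unital) $F$-algebra generated by the vertices $v$, the edges $e$ and the inverse edges $e^*$ subject to: $v^2=v$; $vw=0$ for vertices $v\ne w$; $s(e)e=e\,r(e)=e$ and $r(e)e^*=e^*s(e)=e^*$; $e^*e=r(e)$; $e^*f=0$ for edges $e\neq f$; and $v=\sum_{s(e)=v}ee^*$ for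 every vertex $v$ whose out-degree is finite and non-zero. The Leavitt inverse semigroup $LI(\Gamma)$ is the multiplicative subsemigroup of $L_F(\Gamma)$ generated by $0$ and all $v$, $e$, $e^*$. For a set $A$ and a group $G$, the Brandt semigroup $B_A(G)$ is $(A\times G\times A)\cup\{0\}$ with $(a,g,b)(c,h,d)=(a,gh,d)$ if $b=c$, all other products being $0$. **Theorem.** Let $F$ be a field and let $\Gamma$ be a connected graph. Every vertex of $\Gamma$ has out-degree at most $1$ if and only if $\Gamma$ admits a directed immersion into the circle. Suppose that this is the case. Then: (a) if $\Gamma$ is a tree, then $LI(\Gamma)\cong B_{\Gamma^0}(1)$, where $1$ is the trivial group; (b) if $\Gamma$ is not a tree, then $LI(\Gamma)\cong B_{\Gamma^0}(\mathbb Z)$. -/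

import Mathlib

set_option linter.checkUnivs false

/-- A directed graph: loops and multiple edges are allowed. -/
structure DirectedGraph.{u, w} where
  /-- the vertices -/
  V : Type u
  /-- the edges -/
  E : Type w
  /-- the source map -/
  s : E → V
  /-- the range map -/
  r : E → V

namespace DirectedGraph

/-- A morphism of directed graphs. -/
structure Hom (Γ Δ : DirectedGraph) where
  onV : Γ.V → Δ.V
  onE : Γ.E → Δ.E
  map_s : ∀ e, onV (Γ.s e) = Δ.s (onE e)
  map_r : ∀ e, onV (Γ.r e) = Δ.r (onE e)

/-- The map that a morphism induces on the edges with source `v`. -/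
def Hom.star {Γ Δ : DirectedGraph} (f : Hom Γ Δ) (v : Γ.V) :
    {e : Γ.E // Γ.s e = v} → {e : Δ.E // Δ.s e = f.onV v} :=
  fun e => ⟨f.onE e.1, by rw [← f.map_s, e.2]⟩

/-- Directed immersions: the induced maps on out-going edges are injective. -/
def Hom.IsDirectedImmersion {Γ Δ : DirectedGraph} (f : Hom Γ Δ) : Prop :=
  ∀ v, Function.Injective (f.star v)

/-- The circle: the graph with one vertex and one edge (a loop). -/
def circle : DirectedGraph where
  V := Unit
  E := Unit
  s := fun _ => ()
  r := fun _ => ()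

/-- `Γ` admits a directed immersion into the circle. -/
def ImmersesIntoCircle (Γ : DirectedGraph) : Prop :=
  ∃ f : Hom Γ circle, f.IsDirectedImmersion

/-- The out-degree of a vertex. -/
noncomputable def outDegree (Γ : DirectedGraph) (v : Γ.V) : ℕ∞ :=
  {e : Γ.E | Γ.s e = v}.encard

/-- Edges `e` (positive) together with formal inverse edges `e*` (`ghost e`). -/
inductive SignedEdge (Γ : DirectedGraph)
  | edge (e : Γ.E) : SignedEdge Γ
  | ghost (e : Γ.E) : SignedEdge Γ

namespace SignedEdge

variable {Γ : DirectedGraph}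

/-- The source of a signed edge. -/
def src : SignedEdge Γ → Γ.V
  | edge e => Γ.s e
  | ghost e => Γ.r e

/-- The range of a signed edge. -/
def tgt : SignedEdge Γ → Γ.V
  | edge e => Γ.r e
  | ghost e => Γ.s e

/-- The involution `e ↦ e*`, with `(e*)* = e`. -/
def inv : SignedEdge Γ → SignedEdge Γ
  | edge e => ghost e
  | ghost e => edge e

end SignedEdge

/-- `Γ.IsPath v p w`: the sequence `p` of signed edges is a (not necessarily directed) path from
`v` to `w`; the empty sequence is the empty path at `v = w`. -/
def IsPath (Γ : DirectedGraph) : Γ.V → List Γ.SignedEdge → Γ.V → Prop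
  | v, [], w => v = w
  | v, a :: p, w => a.src = v ∧ Γ.IsPath a.tgt p w

/-- `p = e₁ ⋯ eₙ` is a reduced circuit at `v`: a path from `v` to `v` with `eᵢ ≠ eᵢ₊₁*` for all `i`
and `e₁ ≠ eₙ*`. -/
def IsReducedCircuit (Γ : DirectedGraph) (v : Γ.V) (p : List Γ.SignedEdge) : Prop :=
  Γ.IsPath v p v ∧ List.IsChain (fun a b => a ≠ b.inv) p ∧
    ∀ a ∈ p.head?, ∀ b ∈ p.getLast?, a ≠ b.inv

/-- Any two vertices are joined by a (not necessarily directed) path. -/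
def Connected (Γ : DirectedGraph) : Prop :=
  ∀ v w : Γ.V, ∃ p, Γ.IsPath v p w

/-- A tree: a connected graph without non-trivial reduced circuits. -/
def IsTree (Γ : DirectedGraph) : Prop :=
  Γ.Connected ∧ ∀ v p, Γ.IsReducedCircuit v p → p = []

/-! ### The Leavitt path algebra and the Leavitt inverse semigroup -/

/-- The generators of the Leavitt path algebra: vertices `v`, edges `e`, inverse edges `e*`. -/
inductive Gen (Γ : DirectedGraph)
  | vert (v : Γ.V) : Gen Γ
  | edge (e : Γ.E) : Gen Γ
  | ghost (e : Γ.E) : Gen Γ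

section Leavitt

variable (F : Type*) [Field F] (Γ : DirectedGraph)

/-- The free associative non-unital `F`-algebra on the generators: the semigroup algebra of the
free semigroup. -/
abbrev FreeAlg := MonoidAlgebra F (FreeSemigroup Γ.Gen)

/-- A generator as an element of the free non-unital algebra. -/
noncomputable def free (x : Γ.Gen) : FreeAlg F Γ :=
  MonoidAlgebra.single (FreeSemigroup.of x) 1

/-- The defining relations of the Leavitt path algebra. -/
inductive LeavittRel : FreeAlg F Γ → FreeAlg F Γ → Prop
  | vert_vert (v : Γ.V) :
      LeavittRel (free F Γ (.vert v) * free F Γ (.vert v)) (free F Γ (.vert v))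
  | s_edge (e : Γ.E) :
      LeavittRel (free F Γ (.vert (Γ.s e)) * free F Γ (.edge e)) (free F Γ (.edge e))
  | edge_r (e : Γ.E) :
      LeavittRel (free F Γ (.edge e) * free F Γ (.vert (Γ.r e))) (free F Γ (.edge e))
  | r_ghost (e : Γ.E) :
      LeavittRel (free F Γ (.vert (Γ.r e)) * free F Γ (.ghost e)) (free F Γ (.ghost e))
  | ghost_s (e : Γ.E) :
      LeavittRel (free F Γ (.ghost e) * free F Γ (.vert (Γ.s e))) (free F Γ (.ghost e))
  | vert_ne (v w : Γ.V) : v ≠ w →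
      LeavittRel (free F Γ (.vert v) * free F Γ (.vert w)) 0
  | ghost_ne (e f : Γ.E) : e ≠ f →
      LeavittRel (free F Γ (.ghost e) * free F Γ (.edge f)) 0
  | ghost_edge (e : Γ.E) :
      LeavittRel (free F Γ (.ghost e) * free F Γ (.edge e)) (free F Γ (.vert (Γ.r e)))
  | cuntz_krieger (v : Γ.V) (hfin : {e : Γ.E | Γ.s e = v}.Finite)
      (hne : {e : Γ.E | Γ.s e = v}.Nonempty) :
      LeavittRel (free F Γ (.vert v))
        (∑ e ∈ hfin.toFinset, free F Γ (.edge e) * free F Γ (.ghost e))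

/-- The `F`-algebra congruence generated by the relations: the ring congruence generated by all
their scalar multiples. (There is no unit, so the scalar multiples have to be put in by hand.) -/
noncomputable def leavittCon : RingCon (FreeAlg F Γ) :=
  ringConGen fun a b => ∃ (c : F) (x y : FreeAlg F Γ), LeavittRel F Γ x y ∧ a = c • x ∧ b = c • y

/-- The Leavitt path algebra `L_F(Γ)`, an associative, in general non-unital, `F`-algebra. -/
def LeavittPathAlgebra : Type _ := (leavittCon F Γ).Quotient

noncomputable instance : NonUnitalRing (LeavittPathAlgebra F Γ) :=
  inferInstanceAs (NonUnitalRing (leavittCon F Γ).Quotient)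

theorem leavittCon_smul (c : F) {a b : FreeAlg F Γ} (h : leavittCon F Γ a b) :
    leavittCon F Γ (c • a) (c • b) := by
  have h' : RingConGen.Rel _ a b := h
  change RingConGen.Rel _ (c • a) (c • b)
  clear h
  induction h' with
  | of x y h =>
    obtain ⟨d, u, v, huv, rfl, rfl⟩ := h
    exact .of _ _ ⟨c * d, u, v, huv, (mul_smul c d u).symm, (mul_smul c d v).symm⟩
  | refl x => exact .refl _
  | symm _ ih => exact .symm ih
  | trans _ _ ih₁ ih₂ => exact .trans ih₁ ih₂
  | add _ _ ih₁ ih₂ => rw [smul_add, smul_add]; exact .add ih₁ ih₂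
  | mul _ h₂ ih₁ _ =>
    rw [← smul_mul_assoc, ← smul_mul_assoc]
    exact .mul ih₁ h₂

/-- The quotient map from the free non-unital algebra. -/
noncomputable def LeavittPathAlgebra.mk (a : FreeAlg F Γ) : LeavittPathAlgebra F Γ :=
  RingCon.toQuotient (c := leavittCon F Γ) a

noncomputable instance : SMul F (LeavittPathAlgebra F Γ) :=
  ⟨fun c => Quotient.map' (fun a => c • a) fun _ _ h => leavittCon_smul F Γ c h⟩

noncomputable instance : Module F (LeavittPathAlgebra F Γ) where
  one_smul := by rintro ⟨a⟩; exact congrArg (LeavittPathAlgebra.mk F Γ) (one_smul F a)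
  mul_smul c d := by rintro ⟨a⟩; exact congrArg (LeavittPathAlgebra.mk F Γ) (mul_smul c d a)
  smul_zero c := congrArg (LeavittPathAlgebra.mk F Γ) (smul_zero c)
  smul_add c := by
    rintro ⟨a⟩ ⟨b⟩; exact congrArg (LeavittPathAlgebra.mk F Γ) (smul_add c a b)
  add_smul c d := by rintro ⟨a⟩; exact congrArg (LeavittPathAlgebra.mk F Γ) (add_smul c d a)
  zero_smul := by rintro ⟨a⟩; exact congrArg (LeavittPathAlgebra.mk F Γ) (zero_smul F a)

instance : IsScalarTower F (LeavittPathAlgebra F Γ) (LeavittPathAlgebra F Γ) :=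
  ⟨by rintro c ⟨a⟩ ⟨b⟩; exact congrArg (LeavittPathAlgebra.mk F Γ) (smul_mul_assoc c a b)⟩

instance : SMulCommClass F (LeavittPathAlgebra F Γ) (LeavittPathAlgebra F Γ) :=
  ⟨by rintro c ⟨a⟩ ⟨b⟩; exact congrArg (LeavittPathAlgebra.mk F Γ) (mul_smul_comm c a b).symm⟩

/-- The Leavitt inverse semigroup `LI(Γ)`: the multiplicative subsemigroup (with zero) of the
Leavitt path algebra generated by the vertices, the edges and the inverse edges. The zero is
added explicitly, since for a graph with one vertex it need not be a product of generators. -/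
noncomputable def leavittInverseSemigroup : Subsemigroup (LeavittPathAlgebra F Γ) :=
  Subsemigroup.closure
    (insert 0 (Set.range fun x : Γ.Gen => LeavittPathAlgebra.mk F Γ (free F Γ x)))

end Leavitt

end DirectedGraph

/-- The underlying set of the Brandt semigroup `B_A(G)`. -/
inductive BrandtSemigroup (A G : Type*)
  | zero : BrandtSemigroup A G
  | mk (a : A) (g : G) (b : A) : BrandtSemigroup A G

namespace BrandtSemigroup

open Classical in
/-- `(a, g, b) (c, h, d) = (a, g h, d)` if `b = c`, and all other products are `0`. -/
noncomputable def mul {A G : Type*} [Group G] : BrandtSemigroup A G → BrandtSemigroup A G →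
    BrandtSemigroup A G
  | mk a g b, mk c h d => if b = c then mk a (g * h) d else zero
  | zero, _ => zero
  | mk _ _ _, zero => zero

noncomputable instance {A G : Type*} [Group G] : Semigroup (BrandtSemigroup A G) where
  mul := mul
  mul_assoc x y z := by
    change mul (mul x y) z = mul x (mul y z)
    rcases x with _ | ⟨a, g, b⟩ <;> rcases y with _ | ⟨c, h, d⟩ <;> rcases z with _ | ⟨p, k, q⟩ <;>
      simp only [mul]
    · split_ifs <;> rfl
    · by_cases h₁ : b = c <;> by_cases h₂ : d = p <;> simp [h₁, h₂, mul_assoc]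

end BrandtSemigroup

/-! Assign to a path its degree: edges count `1`, inverse edges `-1`. When all out-degrees are at
most one, the Cuntz–Krieger relation reads `e e* = s(e)`, so backtracks of either kind cancel in the
Leavitt path algebra. In a reduced path an inverse edge cannot be followed by an edge, hence a
reduced circuit has constant sign, and one of positive length has nonzero degree. Removing
backtracks and conjugating therefore reduces a closed path of degree zero to a vertex, and the
element of a path depends only on its end points and degree (`pathElt_eq`).

Conversely, letting paths act as shifts on functions on `Γ⁰ × ℤ` shows that different triples
(source, degree, range) give different nonzero elements (`leavittRep_pathElt`, `shiftOp_injective`).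
So the nonzero part of the semigroup is the set of triples realised by paths. Measuring degrees
relative to a base point turns it into `Γ⁰ × H × Γ⁰`, where `H ≤ ℤ` consists of the degrees of
closed paths at the base point. `H` is trivial for a tree and infinite cyclic otherwise. -/

namespace DirectedGraph

/-! ### Immersions into the circle and out-degrees. -/

section Immersion

variable {Γ : DirectedGraph}

/-- Two edges with the same source are equal. -/
def AtMostOneOut (Γ : DirectedGraph) : Prop :=
  ∀ e f : Γ.E, Γ.s e = Γ.s f → e = f

theorem outDegree_le_one_iff : (∀ v, Γ.outDegree v ≤ 1) ↔ Γ.AtMostOneOut := by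
  simp only [outDegree, Set.encard_le_one_iff, Set.mem_ofPred_eq]
  constructor
  · intro h e f hef
    exact h (Γ.s f) e f hef rfl
  · rintro h v e f he hf
    exact h e f (he.trans hf.symm)

theorem immersesIntoCircle_iff : Γ.ImmersesIntoCircle ↔ Γ.AtMostOneOut := by
  constructor
  · rintro ⟨f, hf⟩ e e' h
    have := @hf (Γ.s e') ⟨e, h⟩ ⟨e', rfl⟩ (Subtype.ext rfl)
    exact congrArg Subtype.val this
  · intro h
    refine ⟨⟨fun _ => (), fun _ => (), fun _ => rfl, fun _ => rfl⟩, ?_⟩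
    rintro v ⟨e, he⟩ ⟨f, hf⟩ -
    exact Subtype.ext (h e f (he.trans hf.symm))

end Immersion

/-! ### Paths, reduced circuits and degrees. -/

namespace SignedEdge

variable {Γ : DirectedGraph}

@[simp] theorem inv_inv (a : SignedEdge Γ) : a.inv.inv = a := by cases a <;> rfl

@[simp] theorem src_inv (a : SignedEdge Γ) : a.inv.src = a.tgt := by cases a <;> rfl

@[simp] theorem tgt_inv (a : SignedEdge Γ) : a.inv.tgt = a.src := by cases a <;> rfl

theorem ne_inv (a : SignedEdge Γ) : a ≠ a.inv := by cases a <;> simp [inv]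

/-- The sign of a signed edge: `1` for edges and `-1` for inverse edges. -/
def sign : SignedEdge Γ → ℤ
  | edge _ => 1
  | ghost _ => -1

@[simp] theorem sign_inv (a : SignedEdge Γ) : a.inv.sign = -a.sign := by cases a <;> rfl

theorem sign_eq_one_or (a : SignedEdge Γ) : a.sign = 1 ∨ a.sign = -1 := by
  cases a <;> simp [sign]

end SignedEdge

section Paths

variable {Γ : DirectedGraph}

theorem isPath_append {v w : Γ.V} {p q : List Γ.SignedEdge} :
    Γ.IsPath v (p ++ q) w ↔ ∃ u, Γ.IsPath v p u ∧ Γ.IsPath u q w := by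
  induction p generalizing v with
  | nil => simp [IsPath]
  | cons a p ih => simp [IsPath, ih, and_assoc]

theorem IsPath.append {v u w : Γ.V} {p q : List Γ.SignedEdge} (hp : Γ.IsPath v p u)
    (hq : Γ.IsPath u q w) : Γ.IsPath v (p ++ q) w :=
  isPath_append.2 ⟨u, hp, hq⟩

theorem isPath_nil (v : Γ.V) : Γ.IsPath v [] v := rfl

theorem isPath_singleton (a : Γ.SignedEdge) : Γ.IsPath a.src [a] a.tgt := ⟨rfl, rfl⟩

/-- The inverse path. -/
def reversePath (p : List Γ.SignedEdge) : List Γ.SignedEdge :=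
  (p.map SignedEdge.inv).reverse

theorem IsPath.reversePath {v w : Γ.V} {p : List Γ.SignedEdge} (hp : Γ.IsPath v p w) :
    Γ.IsPath w (reversePath p) v := by
  induction p generalizing v with
  | nil => exact Eq.symm hp
  | cons a p ih =>
    obtain ⟨rfl, h⟩ := hp
    have ha : Γ.IsPath a.tgt [a.inv] a.src := by simpa using isPath_singleton a.inv
    simpa [DirectedGraph.reversePath] using (ih h).append ha

/-- The degree of a path: the number of edges minus the number of inverse edges. -/
def degree (p : List Γ.SignedEdge) : ℤ := (p.map SignedEdge.sign).sum

@[simp] theorem degree_nil : degree ([] : List Γ.SignedEdge) = 0 := rfl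

@[simp] theorem degree_cons (a : Γ.SignedEdge) (p : List Γ.SignedEdge) :
    degree (a :: p) = a.sign + degree p := by simp [degree]

@[simp] theorem degree_append (p q : List Γ.SignedEdge) :
    degree (p ++ q) = degree p + degree q := by simp [degree]

@[simp] theorem degree_reversePath (p : List Γ.SignedEdge) :
    degree (reversePath p) = -degree p := by
  induction p with
  | nil => rfl
  | cons a p ih =>
    have : reversePath (a :: p) = reversePath p ++ [a.inv] := by simp [reversePath]
    rw [this]
    simp [ih, add_comm]

theorem degree_eq_mul_length {p : List Γ.SignedEdge} {c : ℤ} (h : ∀ a ∈ p, a.sign = c) :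
    degree p = p.length * c := by
  rw [degree, List.map_congr_left h]
  simp

/-- Closed paths are built from reduced circuits by insertion of backtracks and conjugation. -/
theorem closedPath_induction {P : Γ.V → List Γ.SignedEdge → Prop}
    (reduced : ∀ v p, Γ.IsReducedCircuit v p → P v p)
    (cancel : ∀ v u p q a, Γ.IsPath v p u → Γ.IsPath u q v → a.src = u → P v (p ++ q) →
      P v (p ++ a :: a.inv :: q))
    (conj : ∀ a p, Γ.IsPath a.tgt p a.tgt → P a.tgt p → P a.src (a :: p ++ [a.inv]))
    {v : Γ.V} {p : List Γ.SignedEdge} (hp : Γ.IsPath v p v) : P v p := by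
  induction hn : p.length using Nat.strong_induction_on generalizing v p with
  | _ n ih =>
    subst hn
    by_cases hchain : List.IsChain (fun a b : Γ.SignedEdge => a ≠ b.inv) p
    · by_cases hend : ∀ a ∈ p.head?, ∀ b ∈ p.getLast?, a ≠ b.inv
      · exact reduced v p ⟨hp, hchain, hend⟩
      · push Not at hend
        obtain ⟨a, ha, b, hb, hab⟩ := hend
        obtain _ | ⟨a', q⟩ := p
        · simp at ha
        obtain rfl : a' = a := by simpa using ha
        rcases List.eq_nil_or_concat' q with rfl | ⟨q, b', rfl⟩
        · obtain rfl : a' = b := by simpa using hb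
          exact absurd hab a'.ne_inv
        obtain rfl : b' = b := by simpa [List.getLast?_cons] using hb
        subst hab
        obtain ⟨rfl, hq⟩ := hp
        obtain ⟨u, hq, hu, -⟩ := isPath_append.1 hq
        subst hu
        have h := conj b'.inv q (by simpa using hq)
          (ih q.length (by simp) (by simpa using hq) rfl)
        simpa using h
    · rw [List.isChain_iff_forall_rel_of_append_cons_cons] at hchain
      push Not at hchain
      obtain ⟨a, b, x, y, rfl, hab⟩ := hchain
      obtain rfl : b = a.inv := by simp [hab]
      obtain ⟨u, hx, rfl, -, hy⟩ := isPath_append.1 hp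
      rw [SignedEdge.tgt_inv] at hy
      exact cancel v _ x y a hx hy rfl (ih _ (by simp) (hx.append hy) rfl)

theorem IsPath.isChain {v w : Γ.V} {p : List Γ.SignedEdge} (hp : Γ.IsPath v p w) :
    List.IsChain (fun a b : Γ.SignedEdge => a.tgt = b.src) p := by
  induction p generalizing v with
  | nil => simp
  | cons a p ih =>
    obtain ⟨-, h⟩ := hp
    rw [List.isChain_cons]
    refine ⟨fun b hb => ?_, ih h⟩
    cases p with
    | nil => simp at hb
    | cons c p =>
      obtain rfl : c = b := by simpa using hb
      exact h.1.symm

theorem IsPath.tgt_getLast {v w : Γ.V} {p : List Γ.SignedEdge} {a : Γ.SignedEdge}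
    (hp : Γ.IsPath v (p ++ [a]) w) : a.tgt = w := by
  obtain ⟨u, -, -, h⟩ := isPath_append.1 hp
  exact h

/-- If `e*` is followed by `f`, then `e` and `f` share their source, so `e = f` and the pair is a
backtrack. Positivity thus propagates backwards along reduced paths. -/
theorem AtMostOneOut.sign_eq_one (h : Γ.AtMostOneOut) {a b : Γ.SignedEdge} (hab : a.tgt = b.src)
    (hne : a ≠ b.inv) (hb : b.sign = 1) : a.sign = 1 := by
  cases b with
  | ghost f => simp [SignedEdge.sign] at hb
  | edge f =>
    cases a with
    | edge e => rfl
    | ghost e => exact absurd (congrArg SignedEdge.ghost (h e f hab)) hne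

/-- If out-degrees are at most one, then a reduced circuit or its inverse is a directed path. -/
theorem IsReducedCircuit.exists_sign (h : Γ.AtMostOneOut) {v : Γ.V} {p : List Γ.SignedEdge}
    (hp : Γ.IsReducedCircuit v p) : ∃ c : ℤ, c ≠ 0 ∧ ∀ a ∈ p, a.sign = c := by
  obtain ⟨hpath, hchain, hend⟩ := hp
  have hpw : p.Pairwise fun a b => b.sign = 1 → a.sign = 1 := by
    have : IsTrans Γ.SignedEdge (fun a b => b.sign = 1 → a.sign = 1) :=
      ⟨fun a b c hab hbc hc => hab (hbc hc)⟩
    rw [← List.isChain_iff_pairwise]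
    have := hpath.isChain
    rw [List.isChain_iff_forall_rel_of_append_cons_cons] at this hchain ⊢
    intro a b x y hxy
    exact h.sign_eq_one (this hxy) (hchain hxy)
  rcases List.eq_nil_or_concat' p with rfl | ⟨q, b, rfl⟩
  · exact ⟨1, one_ne_zero, by simp⟩
  rw [List.pairwise_append] at hpw
  -- The last edge decides: if it is positive, so is everything before it.
  rcases b.sign_eq_one_or with hb | hb
  · refine ⟨1, one_ne_zero, fun a ha => ?_⟩
    rcases List.mem_append.1 ha with ha | ha
    · exact hpw.2.2 a ha b (by simp) hb
    · obtain rfl : a = b := by simpa using ha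
      exact hb
  · refine ⟨-1, by norm_num, fun a ha => ?_⟩
    rcases List.mem_append.1 ha with ha | ha
    · cases q with
      | nil => simp at ha
      | cons c q =>
        -- A positive edge would force the first edge `c` to be positive and then, going once around
        -- the circuit, the last edge `b`, which precedes `c` cyclically.
        refine a.sign_eq_one_or.resolve_left fun ha1 => ?_
        have hc : c.sign = 1 := by
          rcases List.mem_cons.1 ha with rfl | ha
          · exact ha1
          · exact (List.pairwise_cons.1 hpw.1).1 a ha ha1
        have hcb : b.tgt = c.src := (IsPath.tgt_getLast hpath).trans hpath.1.symm
        have hne : b ≠ c.inv := by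
          rintro rfl
          exact hend c (by simp) c.inv (by simp [List.getLast?_cons]) (by simp)
        have := h.sign_eq_one hcb hne hc
        omega
    · obtain rfl : a = b := by simpa using ha
      exact hb

theorem IsReducedCircuit.eq_nil (h : Γ.AtMostOneOut) {v : Γ.V} {p : List Γ.SignedEdge}
    (hp : Γ.IsReducedCircuit v p) (hdeg : degree p = 0) : p = [] := by
  obtain ⟨c, hc, hsign⟩ := hp.exists_sign h
  rw [degree_eq_mul_length hsign] at hdeg
  simpa [hc] using hdeg

/-- Backtracks and conjugation leave the degree unchanged, so only reduced circuits matter, and in a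
tree these are empty. -/
theorem IsTree.degree_eq_zero (h : Γ.IsTree) {v : Γ.V} {p : List Γ.SignedEdge}
    (hp : Γ.IsPath v p v) : degree p = 0 := by
  refine closedPath_induction (P := fun _ p => degree p = 0) ?_ ?_ ?_ hp
  · intro v p hp
    rw [h.2 v p hp, degree_nil]
  · intro v u p q a _ _ _ ih
    simpa using ih
  · intro a p _ ih
    simpa using ih

/-- The degrees of the closed paths at `v`. -/
def loopDegrees (Γ : DirectedGraph) (v : Γ.V) : AddSubgroup ℤ where
  carrier := {n | ∃ p, Γ.IsPath v p v ∧ degree p = n}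
  zero_mem' := ⟨[], rfl, rfl⟩
  add_mem' := by
    rintro _ _ ⟨p, hp, rfl⟩ ⟨q, hq, rfl⟩
    exact ⟨p ++ q, hp.append hq, degree_append p q⟩
  neg_mem' := by
    rintro _ ⟨p, hp, rfl⟩
    exact ⟨reversePath p, hp.reversePath, degree_reversePath p⟩

theorem mem_loopDegrees {v : Γ.V} {n : ℤ} :
    n ∈ Γ.loopDegrees v ↔ ∃ p, Γ.IsPath v p v ∧ degree p = n := Iff.rfl

/-- The degrees of the paths between two vertices, in terms of the degrees of closed paths and of
the degrees `d` of paths from a base point. -/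
theorem exists_path_degree_iff {v₀ : Γ.V} {d : Γ.V → ℤ}
    (hd : ∀ v, ∃ p, Γ.IsPath v₀ p v ∧ degree p = d v) {v w : Γ.V} {n : ℤ} :
    (∃ p, Γ.IsPath v p w ∧ degree p = n) ↔ d v + n - d w ∈ Γ.loopDegrees v₀ := by
  obtain ⟨pv, hpv, hdv⟩ := hd v
  obtain ⟨pw, hpw, hdw⟩ := hd w
  rw [mem_loopDegrees]
  constructor
  · rintro ⟨p, hp, rfl⟩
    refine ⟨pv ++ p ++ reversePath pw, (hpv.append hp).append hpw.reversePath, ?_⟩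
    simp [hdv, hdw, sub_eq_add_neg, add_assoc]
  · rintro ⟨p, hp, hdeg⟩
    refine ⟨reversePath pv ++ p ++ pw, (hpv.reversePath.append hp).append hpw, ?_⟩
    simp [hdv, hdw, hdeg]

end Paths

/-! ### Elements of the Leavitt path algebra given by paths. -/

section Elements

variable (F : Type*) [Field F] {Γ : DirectedGraph}

/-- The image of a generator in the Leavitt path algebra. -/
noncomputable def genElt (x : Γ.Gen) : LeavittPathAlgebra F Γ :=
  LeavittPathAlgebra.mk F Γ (free F Γ x)

theorem mk_eq_of_leavittRel {a b : FreeAlg F Γ} (h : LeavittRel F Γ a b) :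
    LeavittPathAlgebra.mk F Γ a = LeavittPathAlgebra.mk F Γ b :=
  Quotient.sound' (RingConGen.Rel.of _ _ ⟨1, a, b, h, (one_smul F a).symm, (one_smul F b).symm⟩)

/-- The element of the Leavitt path algebra given by a vertex. -/
noncomputable def vertElt (v : Γ.V) : LeavittPathAlgebra F Γ := genElt F (.vert v)

/-- The element of the Leavitt path algebra given by a signed edge. -/
noncomputable def edgeElt : Γ.SignedEdge → LeavittPathAlgebra F Γ
  | .edge e => genElt F (.edge e)
  | .ghost e => genElt F (.ghost e)

theorem vertElt_mul_self (v : Γ.V) : vertElt F v * vertElt F v = vertElt F v :=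
  mk_eq_of_leavittRel F (.vert_vert v)

theorem vertElt_mul_of_ne {v w : Γ.V} (h : v ≠ w) : vertElt F v * vertElt F w = 0 :=
  mk_eq_of_leavittRel F (.vert_ne v w h)

theorem vertElt_mul_edgeElt (a : Γ.SignedEdge) :
    vertElt F a.src * edgeElt F a = edgeElt F a := by
  cases a with
  | edge e => exact mk_eq_of_leavittRel F (.s_edge e)
  | ghost e => exact mk_eq_of_leavittRel F (.r_ghost e)

theorem edgeElt_mul_vertElt (a : Γ.SignedEdge) :
    edgeElt F a * vertElt F a.tgt = edgeElt F a := by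
  cases a with
  | edge e => exact mk_eq_of_leavittRel F (.edge_r e)
  | ghost e => exact mk_eq_of_leavittRel F (.ghost_s e)

/-- For an edge this is the Cuntz–Krieger relation, whose sum has a single term here. -/
theorem edgeElt_mul_inv (h : Γ.AtMostOneOut) (a : Γ.SignedEdge) :
    edgeElt F a * edgeElt F a.inv = vertElt F a.src := by
  cases a with
  | ghost e => exact mk_eq_of_leavittRel F (.ghost_edge e)
  | edge e =>
    have hs : {f : Γ.E | Γ.s f = Γ.s e} = {e} :=
      Set.ext fun f => ⟨fun hf => h f e hf, fun hf => congrArg Γ.s hf⟩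
    have hfin : {f : Γ.E | Γ.s f = Γ.s e}.Finite := hs ▸ Set.finite_singleton e
    have hto : hfin.toFinset = {e} := by
      ext f
      rw [Set.Finite.mem_toFinset, hs, Set.mem_singleton_iff, Finset.mem_singleton]
    have := mk_eq_of_leavittRel F (.cuntz_krieger (Γ.s e) hfin ⟨e, rfl⟩)
    rw [hto, Finset.sum_singleton] at this
    exact this.symm

/-- The element of the Leavitt path algebra given by a path with source `v`. -/
noncomputable def pathElt : Γ.V → List Γ.SignedEdge → LeavittPathAlgebra F Γ
  | v, [] => vertElt F v
  | _, a :: p => edgeElt F a * pathElt a.tgt p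

theorem vertElt_mul_pathElt {v w : Γ.V} {p : List Γ.SignedEdge} (hp : Γ.IsPath v p w) :
    vertElt F v * pathElt F v p = pathElt F v p := by
  cases p with
  | nil => exact vertElt_mul_self F v
  | cons a p =>
    obtain ⟨rfl, -⟩ := hp
    rw [pathElt, ← mul_assoc, vertElt_mul_edgeElt]

theorem pathElt_append {v u w : Γ.V} {p q : List Γ.SignedEdge} (hp : Γ.IsPath v p u)
    (hq : Γ.IsPath u q w) : pathElt F v (p ++ q) = pathElt F v p * pathElt F u q := by
  induction p generalizing v with
  | nil =>
    obtain rfl : v = u := hp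
    exact (vertElt_mul_pathElt F hq).symm
  | cons a p ih =>
    rw [List.cons_append, pathElt, pathElt, ih hp.2, mul_assoc]

theorem pathElt_mul_vertElt {v w : Γ.V} {p : List Γ.SignedEdge} (hp : Γ.IsPath v p w) :
    pathElt F v p * vertElt F w = pathElt F v p := by
  have := pathElt_append F hp (isPath_nil w)
  rw [List.append_nil] at this
  exact this.symm

theorem pathElt_singleton (a : Γ.SignedEdge) : pathElt F a.src [a] = edgeElt F a :=
  edgeElt_mul_vertElt F a

theorem pathElt_mul_of_ne {v u u' w : Γ.V} {p q : List Γ.SignedEdge} (hp : Γ.IsPath v p u)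
    (hq : Γ.IsPath u' q w) (h : u ≠ u') : pathElt F v p * pathElt F u' q = 0 := by
  rw [← pathElt_mul_vertElt F hp, ← vertElt_mul_pathElt F hq, mul_assoc,
    ← mul_assoc (vertElt F u), vertElt_mul_of_ne F h, zero_mul, mul_zero]

/-- Reduced circuits of degree zero are empty; the other two cases of the induction follow from
`edgeElt_mul_inv`. -/
theorem pathElt_of_degree_eq_zero (h : Γ.AtMostOneOut) {v : Γ.V} {p : List Γ.SignedEdge}
    (hp : Γ.IsPath v p v) (hdeg : degree p = 0) : pathElt F v p = vertElt F v := by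
  refine closedPath_induction (P := fun v p => degree p = 0 → pathElt F v p = vertElt F v)
    ?_ ?_ ?_ hp hdeg
  · intro v p hp hdeg
    rw [hp.eq_nil h hdeg, pathElt]
  · rintro v _ p q a hp hq rfl ih hdeg
    rw [← ih (by simpa using hdeg), pathElt_append F hp hq, pathElt_append F hp (w := v), pathElt,
      pathElt, SignedEdge.tgt_inv, ← mul_assoc (edgeElt F a), edgeElt_mul_inv F h,
      vertElt_mul_pathElt F hq]
    exact ⟨rfl, by simp, by simpa using hq⟩
  · intro a p hp ih hdeg
    have hinv : Γ.IsPath a.tgt [a.inv] a.src := by simpa using isPath_singleton a.inv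
    have hinv' : pathElt F a.tgt [a.inv] = edgeElt F a.inv := by
      simpa using pathElt_singleton F a.inv
    rw [List.cons_append, pathElt, pathElt_append F hp hinv, ih (by simpa using hdeg),
      vertElt_mul_pathElt F hinv, hinv', edgeElt_mul_inv F h]

/-- If out-degrees are at most one, then the element given by a path depends only on the end points
and the degree. -/
theorem pathElt_eq (h : Γ.AtMostOneOut) {v w : Γ.V} {p q : List Γ.SignedEdge}
    (hp : Γ.IsPath v p w) (hq : Γ.IsPath v q w) (hdeg : degree p = degree q) :
    pathElt F v p = pathElt F v q := by
  -- With `q⁻¹` the reversed path, `p = p (q⁻¹ q) = (p q⁻¹) q = q`, both bracketed closed paths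
  -- having degree zero.
  have h₁ : pathElt F w (reversePath q ++ q) = vertElt F w :=
    pathElt_of_degree_eq_zero F h (hq.reversePath.append hq) (by simp)
  have h₂ : pathElt F v (p ++ reversePath q) = vertElt F v :=
    pathElt_of_degree_eq_zero F h (hp.append hq.reversePath) (by simp [hdeg])
  rw [← pathElt_mul_vertElt F hp, ← h₁, pathElt_append F hq.reversePath hq, ← mul_assoc,
    ← pathElt_append F hp hq.reversePath, h₂, vertElt_mul_pathElt F hq]

end Elements

/-! ### A representation by shifts that separates the triples (source, degree, range). -/

section Representation

variable (F : Type*) [Field F] {Γ : DirectedGraph}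

open Classical in
/-- The operator on functions on `Γ⁰ × ℤ` that moves `(w, n)` to `(v, n + k)`. -/
noncomputable def shiftOp (v : Γ.V) (k : ℤ) (w : Γ.V) : Module.End F (Γ.V × ℤ → F) where
  toFun f x := if x.1 = v then f (w, x.2 - k) else 0
  map_add' f g := by
    funext x
    by_cases hx : x.1 = v <;> simp [hx]
  map_smul' c f := by
    funext x
    by_cases hx : x.1 = v <;> simp [hx]

theorem shiftOp_mul (v : Γ.V) (k : ℤ) (w : Γ.V) (l : ℤ) (u : Γ.V) :
    shiftOp F v k w * shiftOp F w l u = shiftOp F v (k + l) u := by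
  refine LinearMap.ext fun f => funext fun x => ?_
  simp [shiftOp, sub_sub]

theorem shiftOp_mul_of_ne {w w' : Γ.V} (h : w ≠ w') (v : Γ.V) (k l : ℤ) (u : Γ.V) :
    shiftOp F v k w * shiftOp F w' l u = 0 := by
  refine LinearMap.ext fun f => funext fun x => ?_
  simp [shiftOp, h]

theorem shiftOp_ne_zero (v : Γ.V) (k : ℤ) (w : Γ.V) : shiftOp F v k w ≠ 0 := by
  intro h
  have := congrFun (LinearMap.congr_fun h fun _ => 1) (v, 0)
  simp [shiftOp] at this

theorem shiftOp_injective {v v' w w' : Γ.V} {k k' : ℤ}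
    (h : shiftOp F v k w = shiftOp F v' k' w') : v = v' ∧ k = k' ∧ w = w' := by
  classical
  -- The left operator moves the point mass at `(w, 0)` to `(v, k)`; the right one can have value
  -- `1` there only if all the data agree.
  have := congrFun (LinearMap.congr_fun h (Pi.single (w, 0) 1)) (v, k)
  simp only [shiftOp, LinearMap.coe_mk, AddHom.coe_mk, if_true, sub_self, Pi.single_eq_same] at this
  split_ifs at this with hv
  · refine ⟨hv, ?_⟩
    by_contra hne
    rw [Pi.single_eq_of_ne] at this
    · exact one_ne_zero this
    · intro heq
      rw [Prod.mk.injEq] at heq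
      exact hne ⟨by omega, heq.1.symm⟩
  · exact absurd this one_ne_zero

/-- The operators by which the generators act on functions on `Γ⁰ × ℤ`. -/
noncomputable def genOp : Γ.Gen → Module.End F (Γ.V × ℤ → F)
  | .vert v => shiftOp F v 0 v
  | .edge e => shiftOp F (Γ.s e) 1 (Γ.r e)
  | .ghost e => shiftOp F (Γ.r e) (-1) (Γ.s e)

/-- The action of the free algebra on functions on `Γ⁰ × ℤ`. -/
noncomputable def freeRep : FreeAlg F Γ →ₙₐ[F] Module.End F (Γ.V × ℤ → F) :=
  MonoidAlgebra.liftMagma F (FreeSemigroup.lift (genOp F))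

theorem freeRep_free (x : Γ.Gen) : freeRep F (free F Γ x) = genOp F x := by
  simp [freeRep, free]

/-- The bound on out-degrees enters twice: distinct edges have distinct sources, which gives `e* f =
0`, and Cuntz–Krieger sums have one term. The remaining products compose or vanish by their end
points. -/
theorem freeRep_eq_of_leavittRel (h : Γ.AtMostOneOut) {a b : FreeAlg F Γ}
    (hab : LeavittRel F Γ a b) : freeRep F a = freeRep F b := by
  induction hab with
  | ghost_ne e f hef =>
    simp only [map_mul, freeRep_free, map_zero, genOp]
    exact shiftOp_mul_of_ne F (fun hs => hef (h e f hs)) _ _ _ _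
  | vert_ne v w hvw =>
    simp only [map_mul, freeRep_free, map_zero, genOp]
    exact shiftOp_mul_of_ne F hvw _ _ _ _
  | cuntz_krieger v hfin hne =>
    obtain ⟨e, rfl⟩ := hne
    have hto : hfin.toFinset = {e} := by
      ext f
      rw [Set.Finite.mem_toFinset, Finset.mem_singleton]
      exact ⟨fun hf => h f e hf, fun hf => congrArg Γ.s hf⟩
    simp [hto, freeRep_free, genOp, shiftOp_mul]
  | _ => simp [freeRep_free, genOp, shiftOp_mul]

theorem freeRep_eq_of_leavittCon (h : Γ.AtMostOneOut) {a b : FreeAlg F Γ}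
    (hab : leavittCon F Γ a b) : freeRep F a = freeRep F b := by
  have hab' : RingConGen.Rel _ a b := hab
  clear hab
  induction hab' with
  | of x y hxy =>
    obtain ⟨c, u, v, huv, rfl, rfl⟩ := hxy
    rw [map_smul, map_smul, freeRep_eq_of_leavittRel F h huv]
  | refl x => rfl
  | symm _ ih => exact ih.symm
  | trans _ _ ih₁ ih₂ => exact ih₁.trans ih₂
  | add _ _ ih₁ ih₂ => rw [map_add, map_add, ih₁, ih₂]
  | mul _ _ ih₁ ih₂ => rw [map_mul, map_mul, ih₁, ih₂]

/-- The action of the Leavitt path algebra on functions on `Γ⁰ × ℤ`. -/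
noncomputable def leavittRep (h : Γ.AtMostOneOut) (x : LeavittPathAlgebra F Γ) :
    Module.End F (Γ.V × ℤ → F) :=
  Quotient.liftOn' x (freeRep F) fun _ _ hab => freeRep_eq_of_leavittCon F h hab

theorem leavittRep_zero (h : Γ.AtMostOneOut) : leavittRep F h 0 = 0 :=
  map_zero (freeRep F)

theorem leavittRep_mul (h : Γ.AtMostOneOut) (x y : LeavittPathAlgebra F Γ) :
    leavittRep F h (x * y) = leavittRep F h x * leavittRep F h y := by
  obtain ⟨a⟩ := x
  obtain ⟨b⟩ := y
  exact map_mul (freeRep F) a b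

theorem leavittRep_genElt (h : Γ.AtMostOneOut) (x : Γ.Gen) :
    leavittRep F h (genElt F x) = genOp F x :=
  freeRep_free F x

theorem leavittRep_edgeElt (h : Γ.AtMostOneOut) (a : Γ.SignedEdge) :
    leavittRep F h (edgeElt F a) = shiftOp F a.src a.sign a.tgt := by
  cases a <;> exact leavittRep_genElt F h _

theorem leavittRep_pathElt (h : Γ.AtMostOneOut) {v w : Γ.V} {p : List Γ.SignedEdge}
    (hp : Γ.IsPath v p w) : leavittRep F h (pathElt F v p) = shiftOp F v (degree p) w := by
  induction p generalizing v with
  | nil =>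
    obtain rfl : v = w := hp
    exact leavittRep_genElt F h _
  | cons a p ih =>
    obtain ⟨rfl, hp⟩ := hp
    rw [pathElt, leavittRep_mul, ih hp, leavittRep_edgeElt, shiftOp_mul, degree_cons]

end Representation

end DirectedGraph

/-! ### Multiplication rules in the Brandt semigroup. -/

namespace BrandtSemigroup

variable {A G : Type*} [Group G]

theorem zero_mul (x : BrandtSemigroup A G) : zero * x = zero := by
  cases x <;> rfl

theorem mul_zero (x : BrandtSemigroup A G) : x * zero = zero := by
  cases x <;> rfl

theorem mk_mul_mk (a : A) (g : G) (b : A) (h : G) (d : A) :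
    mk a g b * mk b h d = mk a (g * h) d :=
  if_pos rfl

theorem mk_mul_mk_of_ne {b c : A} (hbc : b ≠ c) (a : A) (g h : G) (d : A) :
    mk a g b * mk c h d = zero :=
  if_neg hbc

end BrandtSemigroup

/-! ### The isomorphism with a Brandt semigroup. -/

namespace DirectedGraph

section Isomorphism

variable (F : Type*) [Field F] {Γ : DirectedGraph}

theorem genElt_mem (x : Γ.Gen) : genElt F x ∈ Γ.leavittInverseSemigroup F :=
  Subsemigroup.subset_closure (Or.inr ⟨x, rfl⟩)

theorem zero_mem_leavittInverseSemigroup : 0 ∈ Γ.leavittInverseSemigroup F :=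
  Subsemigroup.subset_closure (Or.inl rfl)

theorem pathElt_mem (v : Γ.V) (p : List Γ.SignedEdge) :
    pathElt F v p ∈ Γ.leavittInverseSemigroup F := by
  induction p generalizing v with
  | nil => exact genElt_mem F _
  | cons a p ih =>
    refine mul_mem ?_ (ih _)
    cases a <;> exact genElt_mem F _

/-- If out-degrees are at most one and the degrees of the paths from `v` to `w` are the integers
`ι g - d v + d w`, then the Leavitt inverse semigroup is a Brandt semigroup. -/
theorem nonempty_mulEquiv_brandtSemigroup (h : Γ.AtMostOneOut) {G : Type*} [Group G] (ι : G → ℤ)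
    (hmul : ∀ g g', ι (g * g') = ι g + ι g') (hinj : Function.Injective ι) (d : Γ.V → ℤ)
    (hdeg : ∀ v w n, (∃ p, Γ.IsPath v p w ∧ degree p = n) ↔ ∃ g, ι g = d v + n - d w) :
    Nonempty (Γ.leavittInverseSemigroup F ≃* BrandtSemigroup Γ.V G) := by
  have hex : ∀ v g w, ∃ p, Γ.IsPath v p w ∧ degree p = ι g - d v + d w := fun v g w =>
    (hdeg v w _).2 ⟨g, by ring⟩
  choose path hpath hpathdeg using hex
  -- The choice of path is immaterial by `pathElt_eq`; this makes `φ` multiplicative, because the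
  -- correction terms `d` telescope.
  let φ : BrandtSemigroup Γ.V G → LeavittPathAlgebra F Γ
    | .zero => 0
    | .mk v g w => pathElt F v (path v g w)
  have hφpath : ∀ {v w : Γ.V} {p : List Γ.SignedEdge}, Γ.IsPath v p w →
      ∃ x, φ x = pathElt F v p := by
    intro v w p hp
    obtain ⟨g, hg⟩ := (hdeg v w _).1 ⟨p, hp, rfl⟩
    refine ⟨.mk v g w, pathElt_eq F h (hpath v g w) hp ?_⟩
    rw [hpathdeg, hg]
    ring
  have hφmul : ∀ x y, φ (x * y) = φ x * φ y := by
    rintro (_ | ⟨a, g, b⟩) (_ | ⟨c, k, e⟩)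
    · exact (mul_zero (0 : LeavittPathAlgebra F Γ)).symm
    · exact (zero_mul (pathElt F c (path c k e))).symm
    · exact (mul_zero (pathElt F a (path a g b))).symm
    · by_cases hbc : b = c
      · subst hbc
        rw [BrandtSemigroup.mk_mul_mk]
        change pathElt F a _ = pathElt F a _ * pathElt F b _
        rw [← pathElt_append F (hpath a g b) (hpath b k e)]
        refine pathElt_eq F h (hpath _ _ _) ((hpath _ _ _).append (hpath _ _ _)) ?_
        rw [degree_append, hpathdeg, hpathdeg, hpathdeg, hmul]
        ring
      · rw [BrandtSemigroup.mk_mul_mk_of_ne hbc]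
        exact (pathElt_mul_of_ne F (hpath a g b) (hpath c k e) hbc).symm
  have hφmem : ∀ x, φ x ∈ Γ.leavittInverseSemigroup F := by
    rintro (_ | ⟨a, g, b⟩)
    · exact zero_mem_leavittInverseSemigroup F
    · exact pathElt_mem F _ _
  have hφinj : Function.Injective φ := by
    intro x y hxy
    -- The shift operators are nonzero and determine end points and degree, hence `ι g`.
    have hrep := congrArg (leavittRep F h) hxy
    rcases x with _ | ⟨a, g, b⟩ <;> rcases y with _ | ⟨c, k, e⟩
    · rfl
    · change leavittRep F h 0 = leavittRep F h (pathElt F c _) at hrep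
      rw [leavittRep_zero, leavittRep_pathElt F h (hpath c k e)] at hrep
      exact absurd hrep.symm (shiftOp_ne_zero F _ _ _)
    · change leavittRep F h (pathElt F a _) = leavittRep F h 0 at hrep
      rw [leavittRep_zero, leavittRep_pathElt F h (hpath a g b)] at hrep
      exact absurd hrep (shiftOp_ne_zero F _ _ _)
    · change leavittRep F h (pathElt F a _) = leavittRep F h (pathElt F c _) at hrep
      rw [leavittRep_pathElt F h (hpath a g b), leavittRep_pathElt F h (hpath c k e)] at hrep
      obtain ⟨rfl, hk, rfl⟩ := shiftOp_injective F hrep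
      rw [hpathdeg, hpathdeg] at hk
      rw [hinj (by linarith : ι g = ι k)]
  have hφsurj : ∀ y ∈ Γ.leavittInverseSemigroup F, ∃ x, φ x = y := by
    intro y hy
    refine Subsemigroup.closure_induction (p := fun y _ => ∃ x, φ x = y) ?_ ?_ hy
    · rintro _ (rfl | ⟨x, rfl⟩)
      · exact ⟨.zero, rfl⟩
      · cases x with
        | vert v => exact hφpath (isPath_nil v)
        | edge e =>
          have := hφpath (isPath_singleton (SignedEdge.edge e))
          rwa [pathElt_singleton] at this
        | ghost e =>
          have := hφpath (isPath_singleton (SignedEdge.ghost e))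
          rwa [pathElt_singleton] at this
    · rintro _ _ _ _ ⟨x, rfl⟩ ⟨y, rfl⟩
      exact ⟨x * y, hφmul x y⟩
  let Φ : BrandtSemigroup Γ.V G →ₙ* Γ.leavittInverseSemigroup F :=
    { toFun := fun x => ⟨φ x, hφmem x⟩
      map_mul' := fun x y => Subtype.ext (hφmul x y) }
  refine ⟨(MulEquiv.ofBijective Φ ⟨fun x y hxy => hφinj (congrArg Subtype.val hxy), ?_⟩).symm⟩
  rintro ⟨y, hy⟩
  obtain ⟨x, hx⟩ := hφsurj y hy
  exact ⟨x, Subtype.ext hx⟩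

theorem Connected.exists_degree (hΓ : Γ.Connected) (v₀ : Γ.V) :
    ∃ d : Γ.V → ℤ, ∀ v, ∃ p, Γ.IsPath v₀ p v ∧ degree p = d v := by
  choose p hp using hΓ v₀
  exact ⟨fun v => degree (p v), fun v => ⟨p v, hp v, rfl⟩⟩

theorem IsTree.nonempty_mulEquiv (h : Γ.AtMostOneOut) (hT : Γ.IsTree) :
    Nonempty (Γ.leavittInverseSemigroup F ≃* BrandtSemigroup Γ.V Unit) := by
  -- The empty graph counts as a tree but has no base point.
  rcases isEmpty_or_nonempty Γ.V with hV | ⟨⟨v₀⟩⟩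
  · exact nonempty_mulEquiv_brandtSemigroup F h (fun _ => 0) (fun _ _ => rfl)
      (Function.injective_of_subsingleton _) (fun _ => 0) (fun v => hV.elim v)
  · obtain ⟨d, hd⟩ := hT.1.exists_degree v₀
    refine nonempty_mulEquiv_brandtSemigroup F h (fun _ => 0) (fun _ _ => rfl)
      (Function.injective_of_subsingleton _) d fun v w n => ?_
    rw [exists_path_degree_iff hd]
    constructor
    · rintro ⟨p, hp, hpd⟩
      exact ⟨(), by rw [← hpd, hT.degree_eq_zero hp]⟩
    · rintro ⟨-, hg⟩
      rw [← hg]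
      exact zero_mem _

theorem Connected.nonempty_mulEquiv_of_not_isTree (h : Γ.AtMostOneOut) (hΓ : Γ.Connected)
    (hT : ¬ Γ.IsTree) :
    Nonempty (Γ.leavittInverseSemigroup F ≃* BrandtSemigroup Γ.V (Multiplicative ℤ)) := by
  have : ∃ v p, Γ.IsReducedCircuit v p ∧ p ≠ [] := by
    by_contra! hcon
    exact hT ⟨hΓ, hcon⟩
  -- The base point is taken on a nonempty reduced circuit, whose nonzero degree lies in
  -- `loopDegrees v₀`; hence the generator `k` below is nonzero and `m ↦ m * k` identifies `ℤ` with
  -- that subgroup.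
  obtain ⟨v₀, p, hp, hne⟩ := this
  obtain ⟨d, hd⟩ := hΓ.exists_degree v₀
  obtain ⟨k, hk⟩ := Int.subgroup_cyclic (Γ.loopDegrees v₀)
  have hmem : ∀ n, n ∈ Γ.loopDegrees v₀ ↔ ∃ m : ℤ, m * k = n := fun n => by
    rw [hk, AddSubgroup.mem_closure_singleton]
    simp
  have hk0 : k ≠ 0 := by
    rintro rfl
    obtain ⟨m, hm⟩ := (hmem _).1 ⟨p, hp.1, rfl⟩
    exact hne (hp.eq_nil h (by rw [← hm, mul_zero]))
  refine nonempty_mulEquiv_brandtSemigroup F h (fun g => g.toAdd * k)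
    (fun g g' => by rw [toAdd_mul, add_mul]) (fun g g' hgg => ?_) d fun v w n => ?_
  · exact Multiplicative.toAdd.injective (mul_right_cancel₀ hk0 hgg)
  · rw [exists_path_degree_iff hd, hmem]
    exact Multiplicative.toAdd.surjective.exists

end Isomorphism

end DirectedGraph

theorem mainTheorem7 (F : Type*) [Field F] (Γ : DirectedGraph) (hΓ : Γ.Connected) :
    ((∀ v, Γ.outDegree v ≤ 1) ↔ Γ.ImmersesIntoCircle) ∧
    (Γ.ImmersesIntoCircle →
      (Γ.IsTree →
        Nonempty (Γ.leavittInverseSemigroup F ≃* BrandtSemigroup Γ.V Unit)) ∧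
      (¬ Γ.IsTree →
        Nonempty (Γ.leavittInverseSemigroup F ≃* BrandtSemigroup Γ.V (Multiplicative ℤ)))) := by
  rw [DirectedGraph.outDegree_le_one_iff, DirectedGraph.immersesIntoCircle_iff]
  exact ⟨Iff.rfl, fun h => ⟨fun hT => hT.nonempty_mulEquiv F h,
    fun hT => hΓ.nonempty_mulEquiv_of_not_isTree F h hT⟩⟩
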